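/- Let $\mathbf{k}$ be an algebraically closed field of characteristic $0$ and let $X$ be an affine algebraic variety over $\mathbf{k}$ (reduced, not necessarily irreducible) with ring of regular functions $\mathbf{k}[X]$. A locally nilpotent vector field on $X$ is a nonzero $\mathbf{k}$-derivation $\delta$ of $\mathbf{k}[X]$ such that for every $a\in\mathbf{k}[X]$ there is an $n$ with $\delta^n(a)=0$. A partial quotient morphism associated with $\delta$ is a morphism $\rho : X\to Q$ into a normal affine variety $Q$ such that $\rho^*(\mathbf{k}[Q])\subset \operatorname{Ker}\delta$ and general fibers of $\rho$ (those over the closed points of some dense open subset of $Q$) are isomorphic to $\mathbb{A}^1$. Let $\{\delta_\beta \mid \beta\in\mathcal{B}\}$ be an infinite collection of locally nilpotent vector fields on $X$, and for each $\beta\in\mathcal{B}$ let $\rho_\beta : X\to Q_\beta$ be a partial quotient morphism associated with $\delta_\beta$. Suppose that for all $\beta\neq\gamma$ in $\mathcal{B}$ the pair $(\delta_\beta,\delta_\gamma)$ is suitable for $\rho_\beta$ and $\rho_\gamma$, i.e. the morphism $(\rho_\beta,\rho_\gamma) : X\to Q_\beta\times Q_\gamma$ is proper. Let $C$ be a closed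 (not necessarily irreducible) curve in $X$, that is, a closed subvariety of dimension one. Then there is a finite subset $T$ of $\mathcal{B}$ such that for every $\beta\in\mathcal{B}\setminus T$ the morphism $\rho_\beta|_C : C\to Q_\beta$ is proper. -/

import Mathlib

open AlgebraicGeometry CategoryTheory CategoryTheory.Limits

universe u v

noncomputable section

namespace AffineLND

variable {k : Type u} [Field k]

/-- A locally nilpotent vector field on the affine variety with coordinate ring `A`:
a nonzero `k`-derivation `δ` of `A` such that each `a` is killed by some power of `δ`. -/
def IsLocallyNilpotent {A : Type u} [CommRing A] [Algebra k A] (δ : Derivation k A A) : Prop :=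
  δ ≠ 0 ∧ ∀ a : A, ∃ n : ℕ, (⇑δ)^[n] a = 0

variable (k) in
/-- `B` is the coordinate ring of a normal affine variety over `k` (not necessarily irreducible):
it is a finitely generated `k`-algebra all of whose local rings are integrally closed domains
(so `B` is automatically reduced). -/
def IsNormalAffine (B : Type u) [CommRing B] [Algebra k B] : Prop :=
  Algebra.FiniteType k B ∧
    ∀ (p : Ideal B) [p.IsPrime],
      IsDomain (Localization.AtPrime p) ∧ IsIntegrallyClosed (Localization.AtPrime p)

/-- `ρ : X → Q`, given by its comorphism `ρ : k[Q] → k[X]`, is a partial quotient morphism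
associated with `δ`: `Q` is a normal affine variety, the image of `k[Q]` lies in the kernel of
`δ`, and general fibres of `ρ` are isomorphic to the affine line. The scheme-theoretic fibre over
the closed point with maximal ideal `m` is the spectrum of `k[X] / m k[X]`; "general" means over
all closed points of some dense open subset of `Q`. -/
def IsPartialQuotient {A B : Type u} [CommRing A] [Algebra k A] [CommRing B] [Algebra k B]
    (δ : Derivation k A A) (ρ : B →ₐ[k] A) : Prop :=
  IsNormalAffine k B ∧
    (∀ b : B, δ (ρ b) = 0) ∧
    ∃ U : Set (PrimeSpectrum B), IsOpen U ∧ Dense U ∧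
      ∀ q ∈ U, q.asIdeal.IsMaximal →
        Nonempty ((A ⧸ q.asIdeal.map ρ) ≃ₐ[k] Polynomial k)

/-- The morphism of affine schemes `Spec A ⟶ Spec B` with comorphism `f : B → A`. -/
abbrev morphism {A B : Type u} [CommRing A] [Algebra k A] [CommRing B] [Algebra k B]
    (f : B →ₐ[k] A) : Spec (.of A) ⟶ Spec (.of B) :=
  Spec.map (CommRingCat.ofHom f.toRingHom)

variable (k) in
/-- The structure morphism `Spec A ⟶ Spec k` of the affine `k`-scheme with coordinate ring `A`. -/
abbrev toBase (A : Type u) [CommRing A] [Algebra k A] : Spec (.of A) ⟶ Spec (.of k) :=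
  Spec.map (CommRingCat.ofHom (algebraMap k A))

theorem morphism_toBase {A B : Type u} [CommRing A] [Algebra k A] [CommRing B] [Algebra k B]
    (f : B →ₐ[k] A) : morphism f ≫ toBase k B = toBase k A := by
  rw [← Spec.map_comp, ← CommRingCat.ofHom_comp]
  congr 2
  exact f.comp_algebraMap

/-- The morphism `(ρ₁, ρ₂) : X → Q₁ × Q₂`, the product being the fibre product over `Spec k`. -/
def pairMorphism {A B₁ B₂ : Type u} [CommRing A] [Algebra k A] [CommRing B₁] [Algebra k B₁]
    [CommRing B₂] [Algebra k B₂] (ρ₁ : B₁ →ₐ[k] A) (ρ₂ : B₂ →ₐ[k] A) :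
    Spec (.of A) ⟶ pullback (toBase k B₁) (toBase k B₂) :=
  pullback.lift (morphism ρ₁) (morphism ρ₂)
    ((morphism_toBase ρ₁).trans (morphism_toBase ρ₂).symm)

/-- The pair `δ₁, δ₂` is suitable for the morphisms `ρ₁ : X → Q₁` and `ρ₂ : X → Q₂`: each `ρᵢ` is
a partial quotient morphism associated with `δᵢ`, and `(ρ₁, ρ₂) : X → Q₁ × Q₂` is proper. -/
def IsSuitableFor {A B₁ B₂ : Type u} [CommRing A] [Algebra k A] [CommRing B₁] [Algebra k B₁]
    [CommRing B₂] [Algebra k B₂] (δ₁ δ₂ : Derivation k A A)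
    (ρ₁ : B₁ →ₐ[k] A) (ρ₂ : B₂ →ₐ[k] A) : Prop :=
  IsPartialQuotient δ₁ ρ₁ ∧ IsPartialQuotient δ₂ ρ₂ ∧ IsProper (pairMorphism ρ₁ ρ₂)

/-- The ideal `I` of `A` defines a closed curve in `Spec A`: `I` is radical and its zero locus is
one-dimensional (not necessarily irreducible). -/
def IsCurveIdeal {A : Type u} [CommRing A] (I : Ideal A) : Prop :=
  I.IsRadical ∧ ringKrullDim (A ⧸ I) = 1

variable (k) in
/-- The inclusion into `Spec A` of its closed subscheme with ideal `I`. -/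
abbrev closedInclusion {A : Type u} [CommRing A] [Algebra k A] (I : Ideal A) :
    Spec (.of (A ⧸ I)) ⟶ Spec (.of A) :=
  morphism (Ideal.Quotient.mkₐ k I)

end AffineLND

end

/-!
A morphism of affine varieties is proper exactly when its comorphism is integral, so the theorem is a
statement about integrality, which is tested by valuations: a domain `R` with fraction field `K` fails to be integral
over the image of `S → R` exactly when some valuation subring of `K` contains that image but not `R`
(`mem_valuationSubring_of_isIntegral`, `exists_valuationSubring_of_not_isIntegral`).

When `R` is the coordinate ring of an irreducible curve, only finitely many valuation subrings of `K`
contain `k` but not `R`; these are the places at infinity (`finite_valuationSubring_not_ge`). Indeed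
`R` is integral over `k[x]` for some `x`, and at a place at infinity `x` has a pole; so the place
contains the integral closure `D` of `k[x⁻¹]` in `K`, a Dedekind domain in which only finitely many
primes contain `x⁻¹`, and it is the localization of `D` at one of them.

Now a map `ρ β` that is not proper on the curve has a place at infinity at which all functions in its
image are regular. Two distinct indices cannot share such a place: by suitability `R` is integral over
the subring generated by the two images, so it would be contained in the valuation subring. Hence on
each component the number of bad indices is at most the number of places at infinity
(`finite_not_isIntegral_of_isDomain`). Finally, integrality can be tested on the finitely many
irreducible components (`isIntegral_of_forall_minimalPrimes`).
-/

namespace AffineLND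

open scoped Polynomial TensorProduct

/-! ### Noether normalization in dimension at most one -/

theorem ringKrullDim_le_of_isIntegral_injective {R S : Type*} [CommRing R] [CommRing S]
    (f : R →+* S) (hinj : Function.Injective f) (hint : f.IsIntegral) :
    ringKrullDim R ≤ ringKrullDim S := by
  algebraize [f]
  refine iSup_le fun l ↦ ?_
  have hbot : (⊥ : Ideal S).comap (algebraMap R S) ≤ l.head.asIdeal :=
    (Ideal.comap_bot_of_injective f hinj).trans_le bot_le
  obtain ⟨P, -, hP, hlo⟩ :=
    Ideal.exists_ideal_over_prime_of_isIntegral l.head.asIdeal (⊥ : Ideal S) hbot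
  have : P.LiesOver l.head.asIdeal := ⟨hlo.symm⟩
  obtain ⟨L, hL, -⟩ := Ideal.exists_ltSeries_of_hasGoingUp l P
  rw [← hL]
  exact le_iSup (fun L : LTSeries (PrimeSpectrum S) ↦ (L.length : WithBot ℕ∞)) L

/-- Noether normalization in dimension at most one. The element `x` may be algebraic over `k`; this
covers the case of dimension zero. -/
theorem exists_isIntegral_aeval_of_ringKrullDim_le_one (k R : Type*) [Field k] [CommRing R]
    [Nontrivial R] [Algebra k R] [Algebra.FiniteType k R] (hdim : ringKrullDim R ≤ 1) :
    ∃ x : R, (Polynomial.aeval x : k[X] →ₐ[k] R).IsIntegral := by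
  obtain ⟨s, g, hinj, hint⟩ := exists_integral_inj_algHom_of_fg k R
  have hs : (s : WithBot ℕ∞) ≤ 1 := by
    refine le_trans ?_ hdim
    refine le_trans ?_ (ringKrullDim_le_of_isIntegral_injective g.toRingHom hinj hint)
    rw [MvPolynomial.ringKrullDim_of_isNoetherianRing]
    simp
  have hs' : s ≤ 1 := by exact_mod_cast hs
  have : Subsingleton (Fin s) := by
    interval_cases s <;> infer_instance
  obtain ⟨x, hx⟩ : ∃ x : R, ∀ i, g (MvPolynomial.X i) = x := by
    rcases isEmpty_or_nonempty (Fin s) with h | ⟨⟨i⟩⟩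
    · exact ⟨0, fun i ↦ h.elim i⟩
    · exact ⟨g (MvPolynomial.X i), fun j ↦ by rw [Subsingleton.elim i j]⟩
  have hg : g = (Polynomial.aeval x).comp (MvPolynomial.aeval fun _ ↦ (Polynomial.X : k[X])) := by
    ext i
    simp [hx]
  refine ⟨x, RingHom.IsIntegral.tower_top
    (MvPolynomial.aeval (R := k) fun _ : Fin s ↦ (Polynomial.X : k[X])).toRingHom
    (Polynomial.aeval x : k[X] →ₐ[k] R).toRingHom ?_⟩
  rw [hg] at hint
  exact hint

/-! ### Integrality and valuation subrings -/

theorem mem_valuationSubring_of_isIntegral {R S K : Type*} [CommRing R] [CommRing S] [Field K]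
    (f : S →+* R) (hf : f.IsIntegral) (g : R →+* K) (V : ValuationSubring K)
    (hV : ∀ s, g (f s) ∈ V) (r : R) : g r ∈ V := by
  obtain ⟨p, hp, hpr⟩ := hf r
  have h : IsIntegral V (g r) := by
    refine ⟨p.map ((g.comp f).codRestrict V.toSubring hV), hp.map _, ?_⟩
    have := congrArg g hpr
    rw [Polynomial.hom_eval₂, map_zero] at this
    rw [Polynomial.eval₂_map]
    exact this
  obtain ⟨y, hy⟩ := IsIntegrallyClosed.isIntegral_iff.mp h
  rw [← hy]
  exact y.2

theorem exists_valuationSubring_of_not_isIntegral {R S : Type*} (K : Type*) [CommRing R]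
    [CommRing S] [Field K] [Algebra R K] [FaithfulSMul R K] (f : S →+* R) (hf : ¬ f.IsIntegral) :
    ∃ V : ValuationSubring K, (∀ s, algebraMap R K (f s) ∈ V) ∧ ∃ r, algebraMap R K r ∉ V := by
  obtain ⟨r, hr⟩ := not_forall.mp hf
  let g : S →+* K := (algebraMap R K).comp f
  let C : Subring K := (integralClosure g.range K).toSubring
  have hrC : algebraMap R K r ∉ C := by
    intro h
    apply hr
    obtain ⟨p, hp, hpr⟩ : IsIntegral g.range (algebraMap R K r) := h
    obtain ⟨q, hq, -, hqm⟩ := Polynomial.lifts_and_degree_eq_and_monic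
      ((Polynomial.mem_lifts p).mpr <|
        Polynomial.map_surjective _ g.rangeRestrict_surjective p) hp
    refine ⟨q, hqm, FaithfulSMul.algebraMap_injective R K ?_⟩
    rw [Polynomial.hom_eval₂, map_zero, ← hpr, ← hq, Polynomial.eval₂_map]
    rfl
  have : IsIntegrallyClosedIn C K :=
    inferInstanceAs (IsIntegrallyClosedIn (integralClosure g.range K) K)
  obtain ⟨V, hV, hrV⟩ := Subring.exists_le_valuationSubring_of_isIntegrallyClosedIn hrC
  exact ⟨V, fun s ↦ hV <|
    (integralClosure g.range K).algebraMap_mem (⟨g s, s, rfl⟩ : g.range), r, hrV⟩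

/-! ### Places at infinity of an affine curve -/

/-- Only finitely many valuation subrings containing a Dedekind domain `D` have a given nonzero
`t : D` in their maximal ideal: each is the localization of `D` at its centre, which is a prime factor
of `t`. -/
theorem finite_valuationSubring_of_mem_nonunits (D K : Type*) [CommRing D] [IsDedekindDomain D]
    [Field K] [Algebra D K] [IsFractionRing D K] (t : D) (ht : t ≠ 0) :
    {V : ValuationSubring K | (∀ d, algebraMap D K d ∈ V) ∧
      algebraMap D K t ∈ V.nonunits}.Finite := by
  refine ((Ideal.finite_factors (I := Ideal.span {t}) (by simpa using ht)).image
    (IsDedekindDomain.HeightOneSpectrum.valuationSubringAtPrime K)).subset ?_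
  rintro V ⟨hD, htV⟩
  let φ : D →+* V := (algebraMap D K).codRestrict V.toSubring hD
  let P : Ideal D := (IsLocalRing.maximalIdeal V).comap φ
  have hmem (d : D) : d ∈ P ↔ algebraMap D K d ∈ V.nonunits := by
    rw [ValuationSubring.mem_nonunits_iff_exists_mem_maximalIdeal]
    exact ⟨fun h ↦ ⟨hD d, h⟩, fun ⟨_, h⟩ ↦ h⟩
  have htP : t ∈ P := (hmem t).mpr htV
  let v : IsDedekindDomain.HeightOneSpectrum D :=
    ⟨P, inferInstance, fun h ↦ ht (by simpa [h] using htP)⟩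
  refine ⟨v, ?_, ?_⟩
  · exact Ideal.dvd_span_singleton.mpr htP
  · refine ValuationSubring.eq_of_le_of_ne_top _ ?_ ?_
    -- `D_P ≤ V`, and a discrete valuation ring is a maximal proper subring of its fraction field.
    · rintro x ⟨a, s, hs, rfl⟩
      refine V.mul_mem _ _ (hD a) ?_
      by_contra h
      exact hs ((hmem s).mpr (V.mem_nonunits_iff_or.mpr (Or.inr h)))
    · rintro rfl
      rcases (⊤ : ValuationSubring K).mem_nonunits_iff_or.mp htV with h | h
      · exact ht ((FaithfulSMul.algebraMap_eq_zero_iff D K).mp h)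
      · exact h (ValuationSubring.mem_top _)

/-- An algebraic function field in one variable has only finitely many places trivial on `k` at which
a given transcendental element `x₀` has a pole. -/
theorem finite_valuationSubring_of_not_mem (k : Type*) {R : Type*} (K : Type*) [Field k]
    [CharZero k] [CommRing R] [IsDomain R] [Field K] [Algebra k R] [Algebra R K] [Algebra k K]
    [IsScalarTower k R K] [IsFractionRing R K] [Algebra.FiniteType k R] (x₀ : R)
    (hx₀ : Transcendental k x₀) (hint : (Polynomial.aeval x₀ : k[X] →ₐ[k] R).IsIntegral) :
    {V : ValuationSubring K | (∀ c, algebraMap k K c ∈ V) ∧ algebraMap R K x₀ ∉ V}.Finite := by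
  have : Algebra.EssFiniteType R K := .of_isLocalization K (nonZeroDivisors R)
  have : Algebra.EssFiniteType k K := .comp k R K
  have hx := (transcendental_algebraMap_iff (FaithfulSMul.algebraMap_injective R K)).mpr hx₀
  set x := algebraMap R K x₀
  have hx0 : x ≠ 0 := fun h ↦ hx (h ▸ isAlgebraic_zero)
  let φ : k[X] →ₐ[k] K := Polynomial.aeval x⁻¹
  have hφ : Function.Injective φ :=
    transcendental_iff_injective.mp fun h ↦ hx (by simpa using h.inv)
  -- `K` is regarded as an extension of `k(x⁻¹)`, with the variable `X` acting as `x⁻¹`.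
  let : Algebra k[X] K := φ.toRingHom.toAlgebra
  have hmap (p : k[X]) : algebraMap k[X] K p = φ p := rfl
  have : IsScalarTower k k[X] K := .of_algebraMap_eq fun c ↦ by
    rw [hmap, φ.commutes]
  have : FaithfulSMul k[X] K := (faithfulSMul_iff_algebraMap_injective _ _).mpr hφ
  let : Algebra (FractionRing k[X]) K := FractionRing.liftAlgebra k[X] K
  have : IsScalarTower k[X] (FractionRing k[X]) K := FractionRing.isScalarTower_liftAlgebra k[X] K
  have : IsScalarTower k (FractionRing k[X]) K := .of_algebraMap_eq fun c ↦ by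
    rw [IsScalarTower.algebraMap_apply k k[X] (FractionRing k[X]),
      ← IsScalarTower.algebraMap_apply k[X], ← IsScalarTower.algebraMap_apply k]
  have hXinv : algebraMap (FractionRing k[X]) K (algebraMap k[X] _ Polynomial.X)⁻¹ = x := by
    rw [map_inv₀, ← IsScalarTower.algebraMap_apply, hmap]
    simp [φ]
  -- An integral equation of `r` over `k[x]` becomes one over `k(X)` on substituting `X⁻¹` for `x`.
  have hR (r : R) : IsAlgebraic (FractionRing k[X]) (algebraMap R K r) := by
    obtain ⟨p, hp, hpr⟩ := hint r
    let ψ : k[X] →ₐ[k] FractionRing k[X] :=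
      Polynomial.aeval (algebraMap k[X] (FractionRing k[X]) Polynomial.X)⁻¹
    have hψ : (IsScalarTower.toAlgHom k (FractionRing k[X]) K).comp ψ =
        (IsScalarTower.toAlgHom k R K).comp (Polynomial.aeval x₀) := by
      ext
      simp only [AlgHom.comp_apply, ψ, Polynomial.aeval_X]
      exact hXinv
    refine IsIntegral.isAlgebraic ⟨p.map ψ.toRingHom, hp.map _, ?_⟩
    have := congrArg (algebraMap R K) hpr
    rw [Polynomial.hom_eval₂, map_zero] at this
    rw [Polynomial.eval₂_map, ← this]
    exact congrArg (Polynomial.eval₂ · _ p) (congrArg AlgHom.toRingHom hψ)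
  have : Algebra.IsAlgebraic (FractionRing k[X]) K := by
    refine ⟨fun y ↦ ?_⟩
    obtain ⟨a, b, -, rfl⟩ := IsFractionRing.div_surjective (A := R) y
    rw [div_eq_mul_inv]
    exact (hR a).mul (hR b).inv
  have : Algebra.EssFiniteType (FractionRing k[X]) K := .of_comp k _ _
  have : FiniteDimensional (FractionRing k[X]) K := Algebra.finite_of_essFiniteType_of_isAlgebraic
  have : CharZero (FractionRing k[X]) := charZero_of_injective_algebraMap (R := k)
    (algebraMap k (FractionRing k[X])).injective
  have : IsFractionRing (integralClosure k[X] K) K :=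
    integralClosure.isFractionRing_of_finite_extension (FractionRing k[X]) K
  have : IsDedekindDomain (integralClosure k[X] K) := inferInstance
  let t : integralClosure k[X] K := algebraMap k[X] _ Polynomial.X
  have ht : algebraMap (integralClosure k[X] K) K t = x⁻¹ := by
    rw [← IsScalarTower.algebraMap_apply, hmap]
    simp [φ]
  refine (finite_valuationSubring_of_mem_nonunits (integralClosure k[X] K) K t ?_).subset ?_
  · intro h
    rw [h, map_zero] at ht
    exact inv_ne_zero hx0 ht.symm
  · rintro V ⟨hk, hxV⟩
    have hxV' : x⁻¹ ∈ V.nonunits := V.inv_mem_nonunits_iff.mpr (Or.inr hxV)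
    refine ⟨mem_valuationSubring_of_isIntegral (algebraMap k[X] (integralClosure k[X] K))
      (algebraMap_isIntegral_iff.mpr inferInstance) (algebraMap _ K) V fun p ↦ ?_, ht ▸ hxV'⟩
    rw [← IsScalarTower.algebraMap_apply, hmap]
    induction p using Polynomial.induction_on' with
    | add p q hp hq => rw [map_add]; exact V.add_mem _ _ hp hq
    | monomial n c =>
      rw [Polynomial.aeval_monomial]
      exact V.mul_mem _ _ (hk c) (pow_mem (V.nonunits_subset hxV' : x⁻¹ ∈ V) n)

/-- An irreducible affine curve has only finitely many places at infinity. -/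
theorem finite_valuationSubring_not_ge (k R : Type*) [Field k] [CharZero k] [CommRing R]
    [IsDomain R] [Algebra k R] [Algebra.FiniteType k R] (hdim : ringKrullDim R ≤ 1) :
    {V : ValuationSubring (FractionRing R) | (∀ c : k, algebraMap R (FractionRing R)
      (algebraMap k R c) ∈ V) ∧ ∃ r, algebraMap R (FractionRing R) r ∉ V}.Finite := by
  obtain ⟨x, hx⟩ := exists_isIntegral_aeval_of_ringKrullDim_le_one k R hdim
  set K := FractionRing R
  have key (V : ValuationSubring K) (hk : ∀ c : k, algebraMap R K (algebraMap k R c) ∈ V)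
      (hxV : algebraMap R K x ∈ V) (r : R) : algebraMap R K r ∈ V := by
    refine mem_valuationSubring_of_isIntegral (Polynomial.aeval x : k[X] →ₐ[k] R).toRingHom hx
      (algebraMap R K) V (fun p ↦ ?_) r
    change algebraMap R K (Polynomial.aeval x p) ∈ V
    induction p using Polynomial.induction_on' with
    | add p q hp hq => rw [map_add, map_add]; exact V.add_mem _ _ hp hq
    | monomial n c =>
      rw [Polynomial.aeval_monomial, map_mul, map_pow]
      exact V.mul_mem _ _ (hk c) (pow_mem hxV n)
  by_cases hxt : Transcendental k x
  · refine (finite_valuationSubring_of_not_mem k K x hxt hx).subset ?_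
    rintro V ⟨hk, r, hr⟩
    refine ⟨fun c ↦ ?_, fun hxV ↦ hr (key V hk hxV r)⟩
    rw [IsScalarTower.algebraMap_apply k R K]
    exact hk c
  -- If `x` is algebraic, then `R` is integral over `k` and there are no places at infinity.
  · convert Set.finite_empty
    refine Set.eq_empty_of_forall_notMem ?_
    rintro V ⟨hk, r, hr⟩
    refine hr (key V hk ?_ r)
    refine mem_valuationSubring_of_isIntegral (algebraMap k (Algebra.adjoin k {x})) ?_
      ((algebraMap R K).comp (Algebra.adjoin k {x}).val.toRingHom) V hk
      ⟨x, Algebra.self_mem_adjoin_singleton k x⟩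
    rw [algebraMap_isIntegral_iff]
    exact Algebra.IsIntegral.adjoin (by simpa using (not_not.mp hxt).isIntegral)

/-! ### Families of morphisms from a curve -/

/-- Integrality can be tested on the irreducible components. -/
theorem isIntegral_of_forall_minimalPrimes {R S : Type*} [CommRing R] [CommRing S]
    (hfin : (minimalPrimes R).Finite) (f : S →+* R)
    (h : ∀ P ∈ minimalPrimes R, ((Ideal.Quotient.mk P).comp f).IsIntegral) : f.IsIntegral := by
  intro r
  have hp (P : Ideal R) (hP : P ∈ minimalPrimes R) :
      ∃ p : S[X], p.Monic ∧ p.eval₂ f r ∈ P := by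
    obtain ⟨p, hp, hpr⟩ := h P hP (Ideal.Quotient.mk P r)
    refine ⟨p, hp, Ideal.Quotient.eq_zero_iff_mem.mp ?_⟩
    rw [Polynomial.hom_eval₂, hpr]
  choose! p hp hpr using hp
  let q := ∏ P ∈ hfin.toFinset, p P
  have hq : q.Monic := Polynomial.monic_prod_of_monic _ _ fun P hP ↦ hp P (hfin.mem_toFinset.mp hP)
  -- The product of the equations on the components holds modulo the nilradical; a power holds in `R`.
  have hnil : q.eval₂ f r ∈ nilradical R := by
    rw [nilradical, ← Ideal.sInf_minimalPrimes, Submodule.mem_sInf]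
    intro P hP
    have hPf : P ∈ hfin.toFinset := hfin.mem_toFinset.mpr hP
    rw [show q = _ from (Finset.mul_prod_erase _ p hPf).symm, Polynomial.eval₂_mul]
    exact Ideal.mul_mem_right _ P (hpr P hP)
  obtain ⟨n, hn⟩ := hnil
  exact ⟨q ^ n, hq.pow n, by rw [Polynomial.eval₂_pow, hn]⟩

/-- For an irreducible affine curve, choosing for each non-integral `f i` a place at infinity that
contains its image is injective, since a place shared by `i ≠ j` would contain all of `R`. -/
theorem finite_not_isIntegral_of_isDomain {k R ι : Type*} [Field k] [CharZero k] [CommRing R]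
    [IsDomain R] [Algebra k R] [Algebra.FiniteType k R] (hdim : ringKrullDim R ≤ 1)
    {S : ι → Type*} [∀ i, CommRing (S i)] [∀ i, Algebra k (S i)] (f : ∀ i, S i →ₐ[k] R)
    (hf : Pairwise fun i j ↦ (Algebra.TensorProduct.productMap (f i) (f j)).IsIntegral) :
    {i | ¬ (f i).IsIntegral}.Finite := by
  have hV (i) (hi : ¬ (f i).IsIntegral) := exists_valuationSubring_of_not_isIntegral
    (FractionRing R) (f i).toRingHom hi
  choose! V hV hnot using hV
  refine Set.Finite.of_finite_image (f := V)
    ((finite_valuationSubring_not_ge k R hdim).subset ?_) ?_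
  · rintro _ ⟨i, hi, rfl⟩
    refine ⟨fun c ↦ ?_, hnot i hi⟩
    rw [← (f i).commutes]
    exact hV i hi _
  · intro i hi j hj hij
    by_contra hne
    obtain ⟨r, hr⟩ := hnot i hi
    refine hr (mem_valuationSubring_of_isIntegral _ (hf hne) (algebraMap R _) (V i) (fun s ↦ ?_) r)
    induction s using TensorProduct.induction_on with
    | zero => rw [map_zero, map_zero]; exact (V i).zero_mem
    | add s t hs ht => rw [map_add, map_add]; exact (V i).add_mem _ _ hs ht
    | tmul s t =>
      change algebraMap R _ (f i s * f j t) ∈ V i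
      rw [map_mul]
      refine (V i).mul_mem _ _ (hV i hi s) ?_
      rw [hij]
      exact hV j hj t

theorem finite_not_isIntegral {k R ι : Type*} [Field k] [CharZero k] [CommRing R]
    [Algebra k R] [Algebra.FiniteType k R] (hdim : ringKrullDim R ≤ 1)
    {S : ι → Type*} [∀ i, CommRing (S i)] [∀ i, Algebra k (S i)] (f : ∀ i, S i →ₐ[k] R)
    (hf : Pairwise fun i j ↦ (Algebra.TensorProduct.productMap (f i) (f j)).IsIntegral) :
    {i | ¬ (f i).IsIntegral}.Finite := by
  have : IsNoetherianRing R := Algebra.FiniteType.isNoetherianRing k R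
  have hmin := minimalPrimes.finite_of_isNoetherianRing R
  refine (hmin.biUnion (t := fun P ↦
    {i | ¬ ((Ideal.Quotient.mkₐ k P).comp (f i)).IsIntegral}) fun P hP ↦ ?_).subset ?_
  · have : P.IsPrime := hP.1.1
    refine finite_not_isIntegral_of_isDomain ((ringKrullDim_quotient_le P).trans hdim) _ ?_
    intro i j hij
    have h : Algebra.TensorProduct.productMap ((Ideal.Quotient.mkₐ k P).comp (f i))
        ((Ideal.Quotient.mkₐ k P).comp (f j)) =
        (Ideal.Quotient.mkₐ k P).comp (Algebra.TensorProduct.productMap (f i) (f j)) := by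
      ext <;> simp
    rw [h]
    exact (hf hij).trans _ _ (RingHom.isIntegral_of_surjective _ Ideal.Quotient.mk_surjective)
  · intro i hi
    by_contra h
    simp only [Set.mem_iUnion, Set.mem_ofPred_eq, not_exists, not_not] at h
    exact hi (isIntegral_of_forall_minimalPrimes hmin (f i).toRingHom h)

/-! ### Properness of morphisms of affine schemes -/

theorem isIntegral_productMap_of_isProper_pairMorphism {k A B₁ B₂ : Type u} [Field k] [CommRing A]
    [Algebra k A] [CommRing B₁] [Algebra k B₁] [CommRing B₂] [Algebra k B₂] (ρ₁ : B₁ →ₐ[k] A)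
    (ρ₂ : B₂ →ₐ[k] A) [IsProper (pairMorphism ρ₁ ρ₂)] :
    (Algebra.TensorProduct.productMap ρ₁ ρ₂).IsIntegral := by
  have h : pairMorphism ρ₁ ρ₂ ≫ (pullbackSpecIso k B₁ B₂).hom =
      morphism (Algebra.TensorProduct.productMap ρ₁ ρ₂) := by
    rw [← Iso.eq_comp_inv]
    refine pullback.hom_ext ?_ ?_
    · rw [pairMorphism, pullback.lift_fst, Category.assoc, pullbackSpecIso_inv_fst, morphism,
        morphism, ← Spec.map_comp, ← CommRingCat.ofHom_comp]
      have e : (Algebra.TensorProduct.productMap ρ₁ ρ₂).toRingHom.comp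
          Algebra.TensorProduct.includeLeftRingHom = ρ₁.toRingHom :=
        congrArg AlgHom.toRingHom (Algebra.TensorProduct.productMap_left ρ₁ ρ₂)
      rw [e]
    · rw [pairMorphism, pullback.lift_snd, Category.assoc, pullbackSpecIso_inv_snd, morphism,
        morphism, ← Spec.map_comp, ← CommRingCat.ofHom_comp]
      have e : (Algebra.TensorProduct.productMap ρ₁ ρ₂).toRingHom.comp
          Algebra.TensorProduct.includeRight.toRingHom = ρ₂.toRingHom :=
        congrArg AlgHom.toRingHom (Algebra.TensorProduct.productMap_right ρ₁ ρ₂)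
      exact congrArg (fun φ ↦ Spec.map (CommRingCat.ofHom φ)) e.symm
  have : IsProper (morphism (Algebra.TensorProduct.productMap ρ₁ ρ₂)) := by
    rw [← h]
    infer_instance
  have : IsIntegralHom (morphism (Algebra.TensorProduct.productMap ρ₁ ρ₂)) :=
    IsIntegralHom.iff_universallyClosed_and_isAffineHom.mpr ⟨inferInstance, inferInstance⟩
  exact IsIntegralHom.SpecMap_iff.mp this

theorem isProper_morphism_of_isIntegral {k A B : Type u} [Field k] [CommRing A] [Algebra k A]
    [Algebra.FiniteType k A] [CommRing B] [Algebra k B] (f : B →ₐ[k] A) (hf : f.IsIntegral) :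
    IsProper (morphism f) := by
  have : IsFinite (morphism f) := by
    refine (IsFinite.SpecMap_iff _).mpr (RingHom.IsIntegral.to_finite hf ?_)
    refine RingHom.FiniteType.of_comp_finiteType (f := algebraMap k B) ?_
    change (f.toRingHom.comp (algebraMap k B)).FiniteType
    rw [AlgHom.toRingHom_eq_coe, f.comp_algebraMap]
    exact RingHom.finiteType_algebraMap.mpr ‹_›
  infer_instance

end AffineLND

theorem theorem2
    (k : Type u) [Field k] [IsAlgClosed k] [CharZero k]
    (A : Type u) [CommRing A] [Algebra k A] [Algebra.FiniteType k A] [IsReduced A]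
    (ℬ : Type v) [Infinite ℬ]
    (δ : ℬ → Derivation k A A)
    (hδ : ∀ β, AffineLND.IsLocallyNilpotent (δ β))
    (B : ℬ → Type u) [∀ β, CommRing (B β)] [∀ β, Algebra k (B β)]
    (ρ : ∀ β, B β →ₐ[k] A)
    (hρ : ∀ β γ, β ≠ γ → AffineLND.IsSuitableFor (δ β) (δ γ) (ρ β) (ρ γ))
    (I : Ideal A) (hI : AffineLND.IsCurveIdeal I) :
    ∃ T : Finset ℬ, ∀ β, β ∉ T →
      IsProper (AffineLND.closedInclusion k I ≫ AffineLND.morphism (ρ β)) := by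
  let f (β : ℬ) : B β →ₐ[k] A ⧸ I := (Ideal.Quotient.mkₐ k I).comp (ρ β)
  have hfin : {β | ¬ (f β).IsIntegral}.Finite := by
    refine AffineLND.finite_not_isIntegral hI.2.le f fun β γ hβγ ↦ ?_
    have := (hρ β γ hβγ).2.2
    have h : Algebra.TensorProduct.productMap (f β) (f γ) =
        (Ideal.Quotient.mkₐ k I).comp (Algebra.TensorProduct.productMap (ρ β) (ρ γ)) := by
      ext <;> simp [f]
    change (Algebra.TensorProduct.productMap (f β) (f γ)).IsIntegral
    rw [h]
    exact (AffineLND.isIntegral_productMap_of_isProper_pairMorphism (ρ β) (ρ γ)).trans _ _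
      (RingHom.isIntegral_of_surjective _ Ideal.Quotient.mk_surjective)
  refine ⟨hfin.toFinset, fun β hβ ↦ ?_⟩
  have hint : (f β).IsIntegral := by simpa using hβ
  have hcomp : AffineLND.closedInclusion k I ≫ AffineLND.morphism (ρ β) =
      AffineLND.morphism (f β) := by
    rw [← Spec.map_comp, ← CommRingCat.ofHom_comp]
    rfl
  rw [hcomp]
  exact AffineLND.isProper_morphism_of_isIntegral (f β) hint
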